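/- Let $n\ge 1$, let $x_1,\dots,x_n$ be non-zero elements of a field, $\overline{x}_i=x_i^{-1}$, and let $\mathbf a=(a_1,a_2,\ldots)$ be arbitrary elements of that field; put $a_m=0$ for $m\le 0$. For $m\ge 0$ write $(y|\mathbf a)^m=(y+a_1)(y+a_2)\cdots(y+a_m)$, with $(y|\mathbf a)^0=1$. Let $\lambda=(\lambda_1\ge\lambda_2\ge\cdots\ge\lambda_n>0)$ be a partition of length $\ell(\lambda)=n$, with Young diagram $F^\lambda=\{(i,j) : 1\le i\le n,\ 1\le j\le\lambda_i\}$, and let $$ o'_\lambda(\mathbf x,\overline{\mathbf x}|\mathbf a)=\frac{\det\bigl[(x_i|\mathbf a)^{\lambda_j+n-j}-(\overline{x}_i|\mathbf a)^{\lambda_j+n-j}\bigr]_{i,j=1}^{n}}{\frac12\det\bigl[(x_i|\mathbf a)^{n-j}+(\overline{x}_i|\mathbf a)^{n-j}\bigr]_{i,j=1}^{n}} $$ be the factorial difference character, where the denominator is assumed to be defined and non-zero (as it is for indeterminates $x_i$ over a field of characteristic different from $2$). Let $\mathcal T^{eo}_\lambda$ be the set of even orthogonal tableaux of shape $\lambda$,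 that is, the fillings $T$ of $F^\lambda$ with entries from $\{1<\overline 1<2<\overline 2<\cdots<n<\overline n\}$ such that entries weakly increase from left to right along rows; entries weakly increase from top to bottom down columns; no two identical entries appear in any column; neither $k$ nor $\overline k$ appears lower than the $k$th row; and if an entry $k$ appears in the $k$th row, then any entry $\overline k$ in the same row has an entry $k$ immediately above it in the preceding row. Let $\mathcal T^{eod}_\lambda$ be the subset of those $T\in\mathcal T^{eo}_\lambda$ with $T_{k1}\in\{k,\overline k\}$ for all $k=1,\dots,n$, and let $\mathrm{bar}(T)$ be the number of barred entries in the first column of $T$. Then $$ o'_\lambda(\mathbf x,\overline{\mathbf x}|\mathbf a)=\sum_{T\in\mathcal T^{eod}_\lambda}(-1)^{\mathrm{bar}(T)}\prod_{(i,j)\in F^\lambda}\mathrm{wgt}(T_{ij}), $$ where, in box $(i,j)$, $\mathrm{wgt}(k)=x_k+a_{2k-1-n+j-i+\delta_{ik}}$ and $\mathrm{wgt}(\overline k)=\overline{x}_k+a_{2k-n+j-i}$. -/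

import Mathlib

namespace EvenOrthogonal

/-! Rows, columns and letters are indexed from `0` in Lean (`i : Fin n` stands for row `i + 1`, and
so on); the parameters `a 1, a 2, …` keep their usual numbering, and the value `a 0` is never used. -/

/-- The factorial power `(y|a)^m = (y + a₁)(y + a₂) ⋯ (y + aₘ)`, equal to `1` for `m = 0`. -/
def factorialPower {K : Type*} [Field K] (a : ℕ → K) (y : K) (m : ℕ) : K :=
  ∏ r ∈ Finset.range m, (y + a (r + 1))

/-- The parameters extended to all integer indices by `a_m = 0` for `m ≤ 0`. -/
def extendedParam {K : Type*} [Field K] (a : ℕ → K) (m : ℤ) : K :=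
  if 0 < m then a m.toNat else 0

/-- The denominator `½ |(x_i|a)^{n-j} + (x̄_i|a)^{n-j}|`, where `x̄_i = x_i⁻¹`. -/
noncomputable def charDenominator {K : Type*} [Field K] {n : ℕ} (x : Fin n → K) (a : ℕ → K) : K :=
  (1 / 2) * Matrix.det (Matrix.of fun i j : Fin n =>
    factorialPower a (x i) (n - 1 - (j : ℕ)) + factorialPower a (x i)⁻¹ (n - 1 - (j : ℕ)))

/-- The factorial difference character
`o'_λ(x, x̄|a) = |(x_i|a)^{λ_j+n-j} - (x̄_i|a)^{λ_j+n-j}| / (½ |(x_i|a)^{n-j} + (x̄_i|a)^{n-j}|)`. -/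
noncomputable def differenceCharacter {K : Type*} [Field K] {n : ℕ} (lam : Fin n → ℕ)
    (x : Fin n → K) (a : ℕ → K) : K :=
  Matrix.det (Matrix.of fun i j : Fin n =>
    factorialPower a (x i) (lam j + (n - 1 - (j : ℕ)))
      - factorialPower a (x i)⁻¹ (lam j + (n - 1 - (j : ℕ))))
    / charDenominator x a

/-- The ordered alphabet `1 < 1̄ < 2 < 2̄ < ⋯ < n < n̄`. -/
abbrev Letter (n : ℕ) : Type := Fin n ×ₗ Bool

/-- The letter `k`. -/
def plain {n : ℕ} (k : Fin n) : Letter n := toLex (k, false)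

/-- The letter `k̄`. -/
def barred {n : ℕ} (k : Fin n) : Letter n := toLex (k, true)

/-- The index `k` of a letter `k` or `k̄`. -/
def index {n : ℕ} (e : Letter n) : Fin n := (ofLex e).1

/-- Whether a letter is barred. -/
def isBarred {n : ℕ} (e : Letter n) : Bool := (ofLex e).2

/-- A filling of the Young diagram with rows of lengths `lam 0, …, lam (n - 1)` by letters. -/
abbrev Filling {n : ℕ} (lam : Fin n → ℕ) : Type := (i : Fin n) → Fin (lam i) → Letter n

/-- Even orthogonal tableaux. -/
structure IsEvenOrthogonal {n : ℕ} {lam : Fin n → ℕ} (T : Filling lam) : Prop where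
  /-- Entries weakly increase along rows. -/
  row_weak : ∀ (i : Fin n) (j j' : Fin (lam i)), j ≤ j' → T i j ≤ T i j'
  /-- Entries weakly increase down columns. -/
  col_weak : ∀ (i i' : Fin n) (j : Fin (lam i)) (j' : Fin (lam i')),
    i ≤ i' → (j : ℕ) = (j' : ℕ) → T i j ≤ T i' j'
  /-- No two identical entries appear in a column. -/
  col_ne : ∀ (i i' : Fin n) (j : Fin (lam i)) (j' : Fin (lam i')),
    i ≠ i' → (j : ℕ) = (j' : ℕ) → T i j ≠ T i' j'
  /-- Neither `k` nor `k̄` appears lower than the `k`-th row. -/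
  flag : ∀ (i : Fin n) (j : Fin (lam i)), i ≤ index (T i j)
  /-- If `k` appears in row `k`, then every `k̄` in row `k` has a `k` immediately above it. -/
  covered : ∀ k : Fin n, (∃ j : Fin (lam k), T k j = plain k) →
    ∀ j : Fin (lam k), T k j = barred k →
      ∃ (i : Fin n) (j' : Fin (lam i)),
        (i : ℕ) + 1 = (k : ℕ) ∧ (j' : ℕ) = (j : ℕ) ∧ T i j' = plain k

/-- Even orthogonal tableaux whose entry in row `k` of the first column is `k` or `k̄`, for all `k`. -/
structure IsDifferenceTableau {n : ℕ} {lam : Fin n → ℕ} (T : Filling lam) : Prop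
    extends IsEvenOrthogonal T where
  first_col : ∀ (k : Fin n) (j : Fin (lam k)), (j : ℕ) = 0 → T k j = plain k ∨ T k j = barred k

open Classical in
/-- The finite set of all these tableaux of shape `lam`. -/
noncomputable def differenceTableaux {n : ℕ} (lam : Fin n → ℕ) : Finset (Filling lam) :=
  Finset.univ.filter fun T => IsDifferenceTableau T

open Classical in
/-- The number of barred entries in the first column. -/
noncomputable def bar {n : ℕ} {lam : Fin n → ℕ} (T : Filling lam) : ℕ :=
  (Finset.univ.filter fun i : Fin n =>
    ∃ j : Fin (lam i), (j : ℕ) = 0 ∧ isBarred (T i j) = true).card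

/-- The weight of the letter `e` in the box with row `i` and column `j` (both counted from `1`):
`x_k + a_{2k-1-n+j-i+δ_{ik}}` for `e = k` and `x̄_k + a_{2k-n+j-i}` for `e = k̄`. -/
noncomputable def letterWeight {K : Type*} [Field K] {n : ℕ} (x : Fin n → K) (a : ℕ → K)
    (i j : ℕ) (e : Letter n) : K :=
  let k : ℕ := (index e : ℕ) + 1
  if isBarred e then
    (x (index e))⁻¹ + extendedParam a (2 * (k : ℤ) - (n : ℤ) + (j : ℤ) - (i : ℤ))
  else
    x (index e) + extendedParam a
      (2 * (k : ℤ) - 1 - (n : ℤ) + (j : ℤ) - (i : ℤ) + (if i = k then 1 else 0))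

/-- The product of the weights of all entries of a tableau. -/
noncomputable def weight {K : Type*} [Field K] {n : ℕ} {lam : Fin n → ℕ} (x : Fin n → K)
    (a : ℕ → K) (T : Filling lam) : K :=
  ∏ i : Fin n, ∏ j : Fin (lam i), letterWeight x a ((i : ℕ) + 1) ((j : ℕ) + 1) (T i j)

end EvenOrthogonal

/-!
Both sides obey the same branching recursion in the number of variables. Write `y = x_n`,
`ȳ = y⁻¹`, `z_i = x_i + x_i⁻¹`, and record a row of length `m + 1` as `m`, so that the partition
is `κ + 1`.

*Determinants.* The rows of the (transposed) numerator are the antisymmetrizations under `X ↦ X⁻¹`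
of the polynomials `(X|a)^m`, evaluated at the `x_i`. Multiplying the polynomial by `X - ȳ` and then
by `X - y` gives two-term recurrences (`powerDiff_succ`, `powerDiffOne_succ`), so subtracting from
each row a multiple of the next one leaves a sum over an interval of exponents, and multilinearity
turns the numerator into a sum over pairs of interlacing sequences `κ ≥ ν ≥ μ`. After both steps the
last column is zero except in the corner, and since `(X - y)(X - ȳ) = X (X + X⁻¹ - y - ȳ)`, what
remains is `∏ (z_i - z_n)` times a numerator in `n - 1` variables for the parameters
`(0, a₁, a₂, …)`. Summing out the last part of `ν` gives `numerator_succ`.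

*Tableaux.* The letters `n` and `n̄` occupy horizontal strips, so a tableau amounts to the tableau
of shape `μ + 1` of its other letters, the interlacing pair `(ν, μ)` and its last row. The condition
on `k̄` in row `k` leaves two possibilities for that row: either all its letters are `n̄`, or the
number of letters `n` is as large as strictness of the columns permits. The signed sum of the two is
`lastRowWeight`, and `tableauSum_succ` has the shape of `numerator_succ`.

*Denominator.* `(y|a)^m + (ȳ|a)^m` is a monic polynomial of degree `m > 0` in `y + ȳ`, so the
denominator is the Vandermonde product of the `z_i` (`charDenominator_eq`), which accounts for the
factors `∏ (z_i - z_n)`.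
-/

namespace EvenOrthogonal

/-! ### Row operations for sequences with a two-term recurrence -/

theorem det_eq_of_forall_row_eq_smul_add_succ {R : Type*} [CommRing R] {n : ℕ}
    {A B : Matrix (Fin (n + 1)) (Fin (n + 1)) R} (c : Fin n → R)
    (hlast : ∀ j, A (Fin.last n) j = B (Fin.last n) j)
    (h : ∀ (i : Fin n) j, A i.castSucc j = B i.castSucc j + c i * A i.succ j) :
    A.det = B.det := by
  rw [← Matrix.det_submatrix_equiv_self Fin.revPerm A,
    ← Matrix.det_submatrix_equiv_self Fin.revPerm B]
  refine Matrix.det_eq_of_forall_row_eq_smul_add_pred (fun i => c i.rev) (fun j => ?_)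
    fun i j => ?_
  · simpa using hlast j.rev
  · simpa [Fin.rev_succ, Fin.rev_castSucc] using h i.rev j.rev

theorem det_sum_smul_rows {R : Type*} [CommRing R] {n : ℕ} (A : Fin n → Finset ℕ)
    (c : Fin n → ℕ → R) (g : Fin n → ℕ → Fin n → R) :
    Matrix.det (Matrix.of fun j => ∑ r ∈ A j, c j r • g j r) =
      ∑ f ∈ Fintype.piFinset A, (∏ j, c j (f j)) * Matrix.det (Matrix.of fun j => g j (f j)) := by
  have h := (Matrix.detRowAlternating (n := Fin n) (R := R)).toMultilinearMap.map_sum_finset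
    (fun j r => c j r • g j r) A
  refine h.trans (Finset.sum_congr rfl fun f _ => ?_)
  exact (Matrix.detRowAlternating (n := Fin n) (R := R)).toMultilinearMap.map_smul_univ
    (fun j => c j (f j)) (fun j => g j (f j))

/-- Laplace expansion along a last column whose only possibly non-zero entry is the corner. -/
theorem det_of_last_col_eq_zero {R : Type*} [CommRing R] {n : ℕ}
    (A : Matrix (Fin (n + 1)) (Fin (n + 1)) R) (h : ∀ i : Fin n, A i.castSucc (Fin.last n) = 0) :
    A.det = A (Fin.last n) (Fin.last n) *
      Matrix.det (Matrix.of fun i j : Fin n => A i.castSucc j.castSucc) := by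
  rw [Matrix.det_succ_column A (Fin.last n), Fin.sum_univ_castSucc]
  simp only [h, mul_zero, zero_mul, Finset.sum_const_zero, zero_add, Fin.val_last,
    Even.neg_one_pow ⟨n, rfl⟩, one_mul]
  congr 2
  ext i j
  simp [Matrix.submatrix_apply]

/-- A sequence with `v (m + 1) = u m + c m • v m` unrolled from index `p + s + 1` down to `q + s`. -/
theorem recurrence_unroll {R V : Type*} [CommRing R] [AddCommGroup V] [Module R V] (v u : ℕ → V)
    (c : ℕ → R) (h : ∀ m, v (m + 1) = u m + c m • v m) (s : ℕ) {q p : ℕ} (hqp : q ≤ p) :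
    v (p + s + 1) = (∑ r ∈ Finset.Icc q p, (∏ l ∈ Finset.Ico r p, c (l + s + 1)) • u (r + s))
      + (∏ l ∈ Finset.Ico q (p + 1), c (l + s)) • v (q + s) := by
  induction p, hqp using Nat.le_induction with
  | base => simp [h]
  | succ p hqp ih =>
    rw [h, show p + 1 + s = p + s + 1 by omega, ih, smul_add, smul_smul, Finset.smul_sum,
      Finset.sum_Icc_succ_top (show q ≤ p + 1 by omega), Finset.Ico_self, Finset.prod_empty,
      one_smul, Finset.prod_Ico_succ_top (show q ≤ p + 1 by omega), ← add_assoc, add_comm (u _),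
      show p + s + 1 = p + 1 + s by omega]
    congr 1
    · congr 1
      refine Finset.sum_congr rfl fun r hr => ?_
      rw [smul_smul, Finset.prod_Ico_succ_top (Finset.mem_Icc.1 hr).2, mul_comm,
        show p + s + 1 = p + 1 + s by omega]
    · rw [mul_comm]

/-! ### The branching recursion for the numerator -/

/-- The parameters `(0, a₁, a₂, …)`. -/
def shiftParam {K : Type*} [Field K] (a : ℕ → K) (m : ℕ) : K :=
  extendedParam a ((m : ℤ) - 1)

theorem factorialPower_succ {K : Type*} [Field K] (a : ℕ → K) (y : K) (m : ℕ) :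
    factorialPower a y (m + 1) = factorialPower a y m * (y + a (m + 1)) :=
  Finset.prod_range_succ _ _

theorem factorialPower_shiftParam {K : Type*} [Field K] (a : ℕ → K) (y : K) (m : ℕ) :
    factorialPower (shiftParam a) y (m + 1) = y * factorialPower a y m := by
  rw [factorialPower, Finset.prod_range_succ', mul_comm]
  congr 1
  · simp [shiftParam, extendedParam]
  · refine Finset.prod_congr rfl fun r _ => ?_
    have h : (((r + 1 + 1 : ℕ) : ℤ) - 1) = ((r + 1 : ℕ) : ℤ) := by push_cast; ring
    rw [shiftParam, h, extendedParam, if_pos (by positivity), Int.toNat_natCast]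

/-- The numerator of the difference character for the partition with parts `κ j + 1`. -/
noncomputable def numerator {K : Type*} [Field K] {n : ℕ} (κ : Fin n → ℕ) (x : Fin n → K)
    (a : ℕ → K) : K :=
  Matrix.det (Matrix.of fun i j : Fin n =>
    factorialPower a (x i) (κ j + 1 + (n - 1 - (j : ℕ)))
      - factorialPower a (x i)⁻¹ (κ j + 1 + (n - 1 - (j : ℕ))))

section Branching

variable {K : Type*} [Field K] {n : ℕ} (x : Fin n → K) (a : ℕ → K) (y : K)

/-- The vector of differences `(x_i|a)^m - (x̄_i|a)^m`. -/
def powerDiff (m : ℕ) (i : Fin n) : K :=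
  factorialPower a (x i) m - factorialPower a (x i)⁻¹ m

/-- The antisymmetrization under `X ↦ X⁻¹` of `(X - ȳ) (X|a)^m`, at the points `x_i`. -/
noncomputable def powerDiffOne (m : ℕ) (i : Fin n) : K :=
  (x i - y⁻¹) * factorialPower a (x i) m - ((x i)⁻¹ - y⁻¹) * factorialPower a (x i)⁻¹ m

/-- The antisymmetrization under `X ↦ X⁻¹` of `(X - y) (X - ȳ) (X|a)^m`, at the points `x_i`. -/
noncomputable def powerDiffTwo (m : ℕ) (i : Fin n) : K :=
  (x i - y) * (x i - y⁻¹) * factorialPower a (x i) m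
    - ((x i)⁻¹ - y) * ((x i)⁻¹ - y⁻¹) * factorialPower a (x i)⁻¹ m

theorem powerDiff_zero : powerDiff x a 0 = 0 := by
  funext i
  simp [powerDiff, factorialPower]

theorem powerDiff_succ (m : ℕ) :
    powerDiff x a (m + 1) = powerDiffOne x a y m + (y⁻¹ + a (m + 1)) • powerDiff x a m := by
  funext i
  simp only [powerDiff, powerDiffOne, factorialPower_succ, Pi.add_apply, Pi.smul_apply, smul_eq_mul]
  ring

theorem powerDiffOne_succ (m : ℕ) :
    powerDiffOne x a y (m + 1) =
      powerDiffTwo x a y m + (y + a (m + 1)) • powerDiffOne x a y m := by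
  funext i
  simp only [powerDiffTwo, powerDiffOne, factorialPower_succ, Pi.add_apply, Pi.smul_apply,
    smul_eq_mul]
  ring

/-- Because `(X - y) (X - ȳ) = X (X + X⁻¹ - y - ȳ)`, the factor `(X - y) (X - ȳ)` shifts the
parameters and splits off a factor invariant under `X ↦ X⁻¹`. -/
theorem powerDiffTwo_eq (hx : ∀ i, x i ≠ 0) (hy : y ≠ 0) (m : ℕ) (i : Fin n) :
    powerDiffTwo x a y m i =
      (x i + (x i)⁻¹ - (y + y⁻¹)) * powerDiff x (shiftParam a) (m + 1) i := by
  have h := hx i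
  simp only [powerDiffTwo, powerDiff, factorialPower_shiftParam]
  field_simp
  ring

/-- The lower bound `κ_{j+1}` for the `j`-th part of a sequence interlacing `κ`, with `0` for the
last part. -/
def lowerPart (κ : Fin (n + 1) → ℕ) (j : Fin (n + 1)) : ℕ :=
  Fin.snoc (α := fun _ => ℕ) (fun i : Fin n => κ i.succ) 0 j

/-- The first row reduction. The last row needs no row below it, because `powerDiff x a 0 = 0`. -/
theorem numerator_eq_sum_powerDiffOne (κ : Fin (n + 1) → ℕ) (hκ : Antitone κ)
    (x : Fin (n + 1) → K) :
    numerator κ x a = ∑ ν ∈ Fintype.piFinset fun j => Finset.Icc (lowerPart κ j) (κ j),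
      (∏ j, ∏ l ∈ Finset.Ico (ν j) (κ j), (y⁻¹ + a (l + (n - j) + 2))) *
        Matrix.det (Matrix.of fun j => powerDiffOne x a y (ν j + (n - j))) := by
  rw [← det_sum_smul_rows (fun j => Finset.Icc (lowerPart κ j) (κ j))
    (fun j r => ∏ l ∈ Finset.Ico r (κ j), (y⁻¹ + a (l + (n - j) + 2)))
    (fun j r => powerDiffOne x a y (r + (n - j))), numerator, ← Matrix.det_transpose]
  refine det_eq_of_forall_row_eq_smul_add_succ (fun j => ∏ l ∈ Finset.Ico (κ j.succ)
    (κ j.castSucc + 1), (y⁻¹ + a (l + (n - j) + 1))) (fun i => ?_) fun j i => ?_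
  · have h := congrFun (recurrence_unroll (powerDiff x a) (powerDiffOne x a y) _
      (powerDiff_succ x a y) 0 (Nat.zero_le (κ (Fin.last n)))) i
    simpa [powerDiff_zero, lowerPart, powerDiff] using h
  · have h := congrFun (recurrence_unroll (powerDiff x a) (powerDiffOne x a y) _
      (powerDiff_succ x a y) (n - j) (hκ j.castSucc_le_succ)) i
    have e₁ : 1 + (n - (j : ℕ)) = n - j + 1 := by omega
    have e₂ : 1 + (n - ((j : ℕ) + 1)) = n - j := by omega
    simpa [powerDiff, lowerPart, e₁, e₂, add_assoc, one_add_one_eq_two] using h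

/-- The second row reduction, which leaves the last row alone; all other rows then vanish in the last
column, because `powerDiffTwo` has the factor `X - y`. -/
theorem det_powerDiffOne (ν : Fin (n + 1) → ℕ) (hν : Antitone ν) (x : Fin (n + 1) → K) :
    Matrix.det (Matrix.of fun j => powerDiffOne x a (x (Fin.last n)) (ν j + (n - j))) =
      (x (Fin.last n) - (x (Fin.last n))⁻¹) *
          factorialPower a (x (Fin.last n)) (ν (Fin.last n)) *
        ∑ μ ∈ Fintype.piFinset fun j : Fin n => Finset.Icc (ν j.succ) (ν j.castSucc),
          (∏ j : Fin n, ∏ l ∈ Finset.Ico (μ j) (ν j.castSucc),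
            (x (Fin.last n) + a (l + (n - j) + 1))) *
          Matrix.det (Matrix.of fun j i : Fin n =>
            powerDiffTwo x a (x (Fin.last n)) (μ j + (n - 1 - j)) i.castSucc) := by
  set y := x (Fin.last n) with hy
  have hB : Matrix.det (Matrix.of fun j => powerDiffOne x a y (ν j + (n - j))) =
      Matrix.det (Matrix.of (Fin.snoc (α := fun _ => Fin (n + 1) → K)
        (fun j : Fin n => ∑ r ∈ Finset.Icc (ν j.succ) (ν j.castSucc),
          (∏ l ∈ Finset.Ico r (ν j.castSucc), (y + a (l + (n - j) + 1))) •
            powerDiffTwo x a y (r + (n - 1 - j)))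
        (powerDiffOne x a y (ν (Fin.last n))))) := by
    refine det_eq_of_forall_row_eq_smul_add_succ (fun j => ∏ l ∈ Finset.Ico (ν j.succ)
      (ν j.castSucc + 1), (y + a (l + (n - 1 - j) + 1))) (fun i => ?_) fun j i => ?_
    · simp
    · have h := congrFun (recurrence_unroll (powerDiffOne x a y) (powerDiffTwo x a y) _
        (powerDiffOne_succ x a y) (n - 1 - j) (hν j.castSucc_le_succ)) i
      have e₁ : ∀ r, r + (n - (j : ℕ)) = r + (n - 1 - j) + 1 := fun r => by omega
      have e₂ : n - ((j : ℕ) + 1) = n - 1 - j := by omega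
      simpa [e₁, e₂] using h
  rw [hB, det_of_last_col_eq_zero]
  · congr 1
    · simp [powerDiffOne, ← hy]
    · rw [← det_sum_smul_rows (fun j : Fin n => Finset.Icc (ν j.succ) (ν j.castSucc))
        (fun j r => ∏ l ∈ Finset.Ico r (ν j.castSucc), (y + a (l + (n - j) + 1)))
        (fun j r i => powerDiffTwo x a y (r + (n - 1 - j)) i.castSucc)]
      congr 1
      ext j i
      simp [Finset.sum_apply]
  · intro j
    simp [Finset.sum_apply, powerDiffTwo, ← hy]

theorem det_powerDiffTwo (μ : Fin n → ℕ) (hx : ∀ i, x i ≠ 0) (hy : y ≠ 0) :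
    Matrix.det (Matrix.of fun j : Fin n => powerDiffTwo x a y (μ j + (n - 1 - j))) =
      (∏ i, (x i + (x i)⁻¹ - (y + y⁻¹))) * numerator μ x (shiftParam a) := by
  rw [numerator, ← Matrix.det_transpose, ← Matrix.det_mul_column]
  congr 1
  ext i j
  simp [powerDiffTwo_eq x a y hx hy, powerDiff,
    show μ j + (n - 1 - (j : ℕ)) + 1 = μ j + 1 + (n - 1 - j) by omega]

/-- The minimum of `L` and the last entry of `μ`, or `L` if `μ` is empty. -/
def cap : {n : ℕ} → (Fin n → ℕ) → ℕ → ℕ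
  | 0, _, L => L
  | n + 1, μ, L => min L (μ (Fin.last n))

theorem le_cap_iff (μ : Fin n → ℕ) (L c : ℕ) :
    c ≤ cap μ L ↔ c ≤ L ∧ ∀ i : Fin n, (i : ℕ) + 1 = n → c ≤ μ i := by
  cases n with
  | zero => simp [cap]
  | succ n =>
    rw [cap, le_min_iff]
    refine and_congr_right fun _ => ⟨fun h i hi => ?_, fun h => h _ (by simp)⟩
    rwa [show i = Fin.last n from Fin.ext (by simpa using hi)]

/-- The signed contribution of a last row of length `L + 1` made of the letters `k` and `k̄` with
`x_k = y`: `t + 1` unbarred letters followed by barred ones, minus the row of barred letters. -/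
noncomputable def lastRowWeight (t L : ℕ) : K :=
  factorialPower a y (t + 1) * (∏ l ∈ Finset.Ico t L, (y⁻¹ + a (l + 2)))
    - factorialPower a y⁻¹ (L + 1)

/-- The contribution of the last row as a telescoping sum. -/
theorem lastRowWeight_eq_sum {t L : ℕ} (htL : t ≤ L) :
    lastRowWeight a y t L = (y - y⁻¹) * ∑ s ∈ Finset.range (t + 1),
      factorialPower a y s * ∏ l ∈ Finset.Ico s L, (y⁻¹ + a (l + 2)) := by
  induction t with
  | zero =>
    have h : factorialPower a y⁻¹ (L + 1) =
        (∏ l ∈ Finset.Ico 0 L, (y⁻¹ + a (l + 2))) * (y⁻¹ + a 1) := by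
      rw [factorialPower, Finset.prod_range_succ', Finset.range_eq_Ico]
    rw [lastRowWeight, h]
    simp [factorialPower]
    ring
  | succ t ih =>
    rw [Finset.sum_range_succ, mul_add, ← ih (by omega), lastRowWeight, lastRowWeight,
      factorialPower_succ, Finset.prod_eq_prod_Ico_succ_bot (show t < L by omega)]
    ring

/-- The pairs `(ν, μ)` where `ν` is the result of removing the letters `k̄` of the largest index from
the rows above the last one of a tableau of shape `κ + 1`, and `μ` that of removing the letters `k`
too; a row of length `m + 1` is recorded as `m`. -/
def interlacing (κ : Fin (n + 1) → ℕ) : Finset ((Fin n → ℕ) × (Fin n → ℕ)) :=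
  ((Fintype.piFinset fun j : Fin n => Finset.Icc (κ j.succ) (κ j.castSucc)) ×ˢ
    (Fintype.piFinset fun j : Fin n => Finset.range (κ j.castSucc + 1))).filter fun p =>
      (∀ j, p.2 j ≤ p.1 j) ∧ ∀ i j : Fin n, (i : ℕ) + 1 = j → p.1 j ≤ p.2 i

theorem mem_interlacing (κ : Fin (n + 1) → ℕ) (p : (Fin n → ℕ) × (Fin n → ℕ)) :
    p ∈ interlacing κ ↔ (∀ j, κ j.succ ≤ p.1 j) ∧ (∀ j, p.1 j ≤ κ j.castSucc) ∧
      (∀ j, p.2 j ≤ p.1 j) ∧ ∀ i j : Fin n, (i : ℕ) + 1 = j → p.1 j ≤ p.2 i := by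
  simp only [interlacing, Finset.mem_filter, Finset.mem_product, Fintype.mem_piFinset,
    Finset.mem_Icc, Finset.mem_range]
  constructor
  · rintro ⟨⟨h₁, -⟩, h₂, h₃⟩
    exact ⟨fun j => (h₁ j).1, fun j => (h₁ j).2, h₂, h₃⟩
  · rintro ⟨h₁, h₂, h₃, h₄⟩
    exact ⟨⟨fun j => ⟨h₁ j, h₂ j⟩, fun j => by have := h₂ j; have := h₃ j; omega⟩, h₃, h₄⟩

theorem antitone_of_mem_interlacing {κ : Fin (n + 1) → ℕ} {p : (Fin n → ℕ) × (Fin n → ℕ)}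
    (hp : p ∈ interlacing κ) : Antitone p.2 := by
  obtain ⟨-, -, h₁, h₂⟩ := (mem_interlacing κ p).1 hp
  cases n with
  | zero => exact fun i => i.elim0
  | succ n =>
    exact Fin.antitone_iff_succ_le.2 fun i => (h₁ _).trans (h₂ i.castSucc i.succ (by simp))

theorem antitone_of_lowerPart_le {κ ν : Fin (n + 1) → ℕ} (h₁ : ∀ j, lowerPart κ j ≤ ν j)
    (h₂ : ∀ j, ν j ≤ κ j) : Antitone ν :=
  Fin.antitone_iff_succ_le.2 fun i => (h₂ _).trans (by simpa [lowerPart] using h₁ i.castSucc)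

/-- Regrouping of the sum over the two interlacing steps by the rows above the last one. -/
theorem sum_piFinset_eq_sum_interlacing {M : Type*} [AddCommMonoid M] (κ : Fin (n + 1) → ℕ)
    (f : (Fin n → ℕ) → ℕ → (Fin n → ℕ) → M) :
    ∑ ν ∈ Fintype.piFinset fun j => Finset.Icc (lowerPart κ j) (κ j),
      ∑ μ ∈ Fintype.piFinset fun j : Fin n => Finset.Icc (ν j.succ) (ν j.castSucc),
        f (fun j => ν j.castSucc) (ν (Fin.last n)) μ =
    ∑ p ∈ interlacing κ, ∑ s ∈ Finset.range (cap p.2 (κ (Fin.last n)) + 1), f p.1 s p.2 := by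
  rw [Finset.sum_sigma', Finset.sum_sigma']
  refine Finset.sum_bij' (fun q _ => ⟨(fun j => q.1 j.castSucc, q.2), q.1 (Fin.last n)⟩)
    (fun q _ => ⟨Fin.snoc (α := fun _ => ℕ) q.1.1 q.2, q.1.2⟩) ?_ ?_ ?_ ?_ ?_
  · rintro ⟨ν, μ⟩ h
    simp only [Finset.mem_sigma, Fintype.mem_piFinset, Finset.mem_Icc, mem_interlacing,
      Finset.mem_range, Nat.lt_succ_iff, le_cap_iff] at h ⊢
    obtain ⟨h₁, h₂⟩ := h
    refine ⟨⟨fun j => by simpa [lowerPart] using (h₁ j.castSucc).1, fun j => (h₁ _).2,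
      fun j => (h₂ j).2, fun i j hij => ?_⟩, (h₁ _).2, fun i hi => ?_⟩
    · have e : i.succ = j.castSucc := Fin.ext (by simpa using hij)
      exact e ▸ (h₂ i).1
    · have e : i.succ = Fin.last n := Fin.ext (by simpa using hi)
      exact e ▸ (h₂ i).1
  · rintro ⟨⟨ν, μ⟩, s⟩ h
    simp only [Finset.mem_sigma, Fintype.mem_piFinset, Finset.mem_Icc, mem_interlacing,
      Finset.mem_range, Nat.lt_succ_iff, le_cap_iff] at h ⊢
    obtain ⟨⟨h₁, h₂, h₃, h₄⟩, h₅, h₆⟩ := h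
    refine ⟨Fin.forall_fin_succ'.2 ⟨fun j => ?_, ?_⟩, fun j => ⟨?_, ?_⟩⟩
    · simpa [lowerPart] using ⟨h₁ j, h₂ j⟩
    · simpa [lowerPart] using h₅
    · rcases Fin.eq_castSucc_or_eq_last j.succ with ⟨i, hi⟩ | hi
      · rw [hi, Fin.snoc_castSucc]
        exact h₄ j i (by simpa using congrArg Fin.val hi)
      · rw [hi, Fin.snoc_last]
        exact h₆ j (by simpa using congrArg Fin.val hi)
    · simpa using h₃ j
  · rintro ⟨ν, μ⟩ -
    simp only [Sigma.mk.injEq, heq_eq_eq, and_true]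
    exact Fin.snoc_init_self ν
  · rintro ⟨⟨ν, μ⟩, s⟩ -
    simp
  · rintro ⟨ν, μ⟩ -
    rfl

/-- The branching recursion for the numerator; `(ν, μ) = (p.1, p.2)`. -/
theorem numerator_succ (κ : Fin (n + 1) → ℕ) (hκ : Antitone κ) (x : Fin (n + 1) → K)
    (hx : ∀ i, x i ≠ 0) :
    numerator κ x a =
      (∏ i : Fin n, (x i.castSucc + (x i.castSucc)⁻¹
        - (x (Fin.last n) + (x (Fin.last n))⁻¹))) *
      ∑ p ∈ interlacing κ,
        (∏ i : Fin n,
          ((∏ l ∈ Finset.Ico (p.2 i) (p.1 i), (x (Fin.last n) + a (l + (n - i) + 1))) *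
            ∏ l ∈ Finset.Ico (p.1 i) (κ i.castSucc),
              ((x (Fin.last n))⁻¹ + a (l + (n - i) + 2)))) *
          lastRowWeight a (x (Fin.last n)) (cap p.2 (κ (Fin.last n))) (κ (Fin.last n)) *
          numerator p.2 (fun i => x i.castSucc) (shiftParam a) := by
  set y := x (Fin.last n) with hy
  set Z := ∏ i : Fin n, (x i.castSucc + (x i.castSucc)⁻¹ - (y + y⁻¹))
  set L := κ (Fin.last n)
  have hdet : ∀ μ : Fin n → ℕ, Matrix.det (Matrix.of fun j i : Fin n =>
      powerDiffTwo x a y (μ j + (n - 1 - j)) i.castSucc) =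
      Z * numerator μ (fun i => x i.castSucc) (shiftParam a) := fun μ =>
    det_powerDiffTwo (fun i => x i.castSucc) a y μ (fun i => hx _) (hx _)
  have hsum := sum_piFinset_eq_sum_interlacing κ fun ν s μ =>
    (∏ i : Fin n, ((∏ l ∈ Finset.Ico (μ i) (ν i), (y + a (l + (n - i) + 1))) *
      ∏ l ∈ Finset.Ico (ν i) (κ i.castSucc), (y⁻¹ + a (l + (n - i) + 2)))) *
      ((y - y⁻¹) * (factorialPower a y s * ∏ l ∈ Finset.Ico s L, (y⁻¹ + a (l + 2)))) *
      (Z * numerator μ (fun i => x i.castSucc) (shiftParam a))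
  rw [numerator_eq_sum_powerDiffOne a y κ hκ x]
  refine Eq.trans (Finset.sum_congr rfl fun ν hν => ?_) (hsum.trans ?_)
  · simp only [Fintype.mem_piFinset, Finset.mem_Icc] at hν
    rw [hy, det_powerDiffOne a ν
      (antitone_of_lowerPart_le (fun j => (hν j).1) fun j => (hν j).2) x, ← hy,
      Fin.prod_univ_castSucc, Finset.mul_sum, Finset.mul_sum]
    refine Finset.sum_congr rfl fun μ _ => ?_
    rw [hdet, Finset.prod_mul_distrib]
    simp only [Fin.val_castSucc, Fin.val_last, Nat.sub_self, add_zero]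
    ring
  · rw [Finset.mul_sum]
    refine Finset.sum_congr rfl fun p _ => ?_
    rw [lastRowWeight_eq_sum a y ((le_cap_iff p.2 L _).1 le_rfl).1, Finset.mul_sum,
      Finset.mul_sum, Finset.sum_mul, Finset.mul_sum]
    refine Finset.sum_congr rfl fun s _ => ?_
    ring

end Branching

/-! ### The denominator -/

open Polynomial in
/-- `(y|a)^m + (ȳ|a)^m` is a polynomial in `y + ȳ`, monic of degree `m` for `m > 0`. The second
polynomial, for `y (y|a)^m + ȳ (ȳ|a)^m`, makes the induction on `m` run. -/
theorem exists_polynomial_factorialPower_add {K : Type*} [Field K] (a : ℕ → K) (m : ℕ) :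
    ∃ D E : K[X],
      (∀ y : K, y ≠ 0 → D.eval (y + y⁻¹) = factorialPower a y m + factorialPower a y⁻¹ m) ∧
      (∀ y : K, y ≠ 0 →
        E.eval (y + y⁻¹) = y * factorialPower a y m + y⁻¹ * factorialPower a y⁻¹ m) ∧
      (E.Monic ∧ E.natDegree = m + 1) ∧ D.natDegree ≤ m ∧
      (0 < m → D.Monic ∧ D.natDegree = m) := by
  have key : ∀ (p q : K[X]) (d : ℕ), p.Monic → p.natDegree = d + 1 → q.natDegree ≤ d →
      (p + q).Monic ∧ (p + q).natDegree = d + 1 := by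
    intro p q d hp hd hq
    have hlt : q.natDegree < p.natDegree := by omega
    exact ⟨hp.add_of_left (degree_lt_degree hlt), by
      rw [natDegree_add_eq_left_of_natDegree_lt hlt, hd]⟩
  induction m with
  | zero =>
    exact ⟨C 2, X, fun y _ => by simp [factorialPower, one_add_one_eq_two],
      fun y _ => by simp [factorialPower], ⟨monic_X, by simp⟩, by simp, by simp⟩
  | succ m ih =>
    obtain ⟨D, E, hD, hE, ⟨hEm, hEd⟩, hDd, -⟩ := ih
    have h₁ := key E (C (a (m + 1)) * D) m hEm hEd ((natDegree_C_mul_le _ _).trans hDd)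
    refine ⟨E + C (a (m + 1)) * D, X * E + (C (a (m + 1)) * E - D), fun y hy => ?_, fun y hy => ?_,
      ?_, h₁.2.le, fun _ => h₁⟩
    · simp only [eval_add, eval_mul, eval_C, hD y hy, hE y hy, factorialPower_succ]
      ring
    · simp only [eval_add, eval_sub, eval_mul, eval_C, eval_X, hD y hy, hE y hy,
        factorialPower_succ]
      field_simp
      ring
    · refine key (X * E) (C (a (m + 1)) * E - D) (m + 1) (monic_X.mul hEm) ?_ ?_
      · rw [natDegree_X_mul hEm.ne_zero, hEd]
      · refine (natDegree_sub_le _ _).trans (max_le ?_ (by omega))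
        exact (natDegree_C_mul_le _ _).trans hEd.le

/-- The product of the differences `(x_i + x̄_i) - (x_j + x̄_j)` over `i < j`. -/
noncomputable def diffProd {K : Type*} [Field K] {n : ℕ} (x : Fin n → K) : K :=
  ∏ j, ∏ i ∈ Finset.Iio j, (x i + (x i)⁻¹ - (x j + (x j)⁻¹))

theorem diffProd_succ {K : Type*} [Field K] {n : ℕ} (x : Fin (n + 1) → K) :
    diffProd x = (∏ i : Fin n, (x i.castSucc + (x i.castSucc)⁻¹
      - (x (Fin.last n) + (x (Fin.last n))⁻¹))) * diffProd fun i => x i.castSucc := by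
  rw [diffProd, Fin.prod_univ_castSucc, mul_comm]
  congr 1
  · rw [Fin.Iio_last_eq_map, Finset.prod_map]
    rfl
  · refine Finset.prod_congr rfl fun j _ => ?_
    rw [← Fin.map_castSuccEmb_Iio, Finset.prod_map]
    rfl

theorem charDenominator_eq {K : Type*} [Field K] {n : ℕ} (hn : 1 ≤ n) (x : Fin n → K)
    (hx : ∀ i, x i ≠ 0) (a : ℕ → K) (h2 : (2 : K) ≠ 0) :
    charDenominator x a = diffProd x := by
  choose D _ hD _ _ _ hDm using exists_polynomial_factorialPower_add a
  -- The polynomial for the exponent `0` is the constant `2`; halving its column makes it monic.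
  set p : Fin n → Polynomial K := fun j => if (j : ℕ) = 0 then 1 else D j with hp
  have hdeg : ∀ j, (p j).natDegree = j := fun j => by
    by_cases h : (j : ℕ) = 0
    · simp [hp, h]
    · simpa [hp, h] using (hDm j (by omega)).2
  have hmonic : ∀ j, (p j).Monic := fun j => by
    by_cases h : (j : ℕ) = 0
    · simp [hp, h]
    · simpa [hp, h] using (hDm j (by omega)).1
  have hvan := Matrix.det_eval_matrixOfPolynomials_eq_det_vandermonde
    (fun i : Fin n => x i.rev + (x i.rev)⁻¹) p hdeg hmonic
  have hdet : Matrix.det (Matrix.of fun i j : Fin n => factorialPower a (x i) (n - 1 - (j : ℕ)) +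
      factorialPower a (x i)⁻¹ (n - 1 - (j : ℕ))) =
      (∏ j : Fin n, if (j : ℕ) = 0 then (2 : K) else 1) * Matrix.det (Matrix.of
        fun i j : Fin n => (p j).eval (x i.rev + (x i.rev)⁻¹)) := by
    rw [← Matrix.det_mul_row, ← Matrix.det_submatrix_equiv_self Fin.revPerm]
    congr 1
    ext i j
    have e : n - 1 - (n - ((j : ℕ) + 1)) = j := by omega
    by_cases h : (j : ℕ) = 0
    · simp [hp, h, factorialPower, Fin.val_rev, one_add_one_eq_two]
    · simp [hp, e, h, Fin.val_rev, hD _ _ (hx _)]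
  have htwo : (∏ j : Fin n, if (j : ℕ) = 0 then (2 : K) else 1) = 2 := by
    rw [Finset.prod_eq_single (⟨0, hn⟩ : Fin n)]
    · simp
    · intro j _ hj
      exact if_neg fun h => hj (Fin.ext h)
    · simp
  rw [charDenominator, hdet, htwo, ← hvan, Matrix.det_vandermonde, ← mul_assoc,
    one_div_mul_cancel h2, one_mul, diffProd, ← Equiv.prod_comp Fin.revPerm]
  refine Finset.prod_congr rfl fun i _ => ?_
  refine Finset.prod_equiv Fin.revPerm (fun j => ?_) fun j _ => ?_
  · simpa using Fin.rev_lt_iff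
  · simp

/-! ### Removing the letters of the largest index from a tableau -/

section Letters

variable {n : ℕ}

/-- A letter of the alphabet on `n` indices as a letter of the alphabet on `n + 1` indices. -/
def liftLetter (e : Letter n) : Letter (n + 1) := toLex ((index e).castSucc, isBarred e)

theorem le_iff_index (e f : Letter n) :
    e ≤ f ↔ index e < index f ∨ index e = index f ∧ isBarred e ≤ isBarred f :=
  Prod.Lex.le_iff

theorem liftLetter_le_liftLetter {e f : Letter n} : liftLetter e ≤ liftLetter f ↔ e ≤ f := by
  simp [le_iff_index, liftLetter, index, isBarred]

theorem liftLetter_lt_liftLetter {e f : Letter n} : liftLetter e < liftLetter f ↔ e < f := by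
  rw [← not_le, ← not_le, liftLetter_le_liftLetter]

theorem liftLetter_injective : Function.Injective (liftLetter (n := n)) := fun _ _ h =>
  le_antisymm (liftLetter_le_liftLetter.1 h.le) (liftLetter_le_liftLetter.1 h.ge)

theorem liftLetter_plain (k : Fin n) : liftLetter (plain k) = plain k.castSucc := rfl

theorem liftLetter_barred (k : Fin n) : liftLetter (barred k) = barred k.castSucc := rfl

theorem liftLetter_lt_plain_last (e : Letter n) : liftLetter e < plain (Fin.last n) :=
  Prod.Lex.lt_iff.2 (Or.inl (Fin.castSucc_lt_last _))

theorem plain_lt_barred (k : Fin n) : plain k < barred k :=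
  Prod.Lex.lt_iff.2 (Or.inr ⟨rfl, rfl⟩)

theorem le_barred_last (e : Letter (n + 1)) : e ≤ barred (Fin.last n) := by
  refine (le_iff_index _ _).2 ((Fin.le_last (index e)).lt_or_eq.imp id fun h => ⟨h, ?_⟩)
  exact Bool.le_true _

theorem lt_barred_last_iff {e : Letter (n + 1)} :
    e < barred (Fin.last n) ↔ e ≤ plain (Fin.last n) := by
  refine ⟨fun h => (le_iff_index _ _).2 ?_, fun h => h.trans_lt (plain_lt_barred _)⟩
  rcases Prod.Lex.lt_iff.1 h with h | ⟨h, h'⟩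
  · exact Or.inl h
  · exact Or.inr ⟨h, (Bool.lt_iff.1 h').1.le⟩

theorem exists_liftLetter_eq {e : Letter (n + 1)} (h : e < plain (Fin.last n)) :
    ∃ f : Letter n, liftLetter f = e := by
  rcases Prod.Lex.lt_iff.1 h with h | ⟨-, h⟩
  · exact ⟨toLex ((ofLex e).1.castPred h.ne, (ofLex e).2), rfl⟩
  · exact absurd (Bool.lt_iff.1 h).2 (by simp [plain])

theorem plain_castSucc_lt (k : Fin n) : plain k.castSucc < plain (Fin.last n) :=
  liftLetter_lt_plain_last (plain k)

theorem barred_castSucc_lt (k : Fin n) : barred k.castSucc < plain (Fin.last n) :=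
  liftLetter_lt_plain_last (barred k)

end Letters

/-- For shapes with non-empty rows the flag condition is redundant, and the two column conditions
together say that columns increase strictly. -/
theorem isDifferenceTableau_iff {n : ℕ} {κ : Fin n → ℕ} (T : Filling fun i => κ i + 1) :
    IsDifferenceTableau T ↔
      (∀ (i : Fin n) (j j' : Fin (κ i + 1)), j ≤ j' → T i j ≤ T i j') ∧
      (∀ (i i' : Fin n) (j : Fin (κ i + 1)) (j' : Fin (κ i' + 1)),
        i < i' → (j : ℕ) = j' → T i j < T i' j') ∧
      (∀ k : Fin n, (∃ j, T k j = plain k) → ∀ j, T k j = barred k →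
        ∃ (i : Fin n) (j' : Fin (κ i + 1)), (i : ℕ) + 1 = k ∧ (j' : ℕ) = j ∧ T i j' = plain k) ∧
      ∀ k : Fin n, T k 0 = plain k ∨ T k 0 = barred k := by
  constructor
  · rintro ⟨⟨h₁, h₂, h₃, -, h₅⟩, h₆⟩
    exact ⟨h₁, fun i i' j j' hi hj => (h₂ i i' j j' hi.le hj).lt_of_ne (h₃ i i' j j' hi.ne hj),
      h₅, fun k => h₆ k 0 rfl⟩
  · rintro ⟨h₁, h₂, h₃, h₄⟩
    refine ⟨⟨h₁, fun i i' j j' hi hj => ?_, fun i i' j j' hi hj => ?_, fun i j => ?_, h₃⟩,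
      fun k j hj => ?_⟩
    · rcases hi.lt_or_eq with hi | rfl
      · exact (h₂ i i' j j' hi hj).le
      · exact (congrArg (T i) (Fin.ext hj)).le
    · rcases hi.lt_or_gt with hi | hi
      · exact (h₂ i i' j j' hi hj).ne
      · exact (h₂ i' i j' j hi hj.symm).ne'
    · have h0 : index (T i 0) = i := by rcases h₄ i with h | h <;> rw [h] <;> rfl
      rcases (le_iff_index _ _).1 (h₁ i 0 j (Fin.zero_le _)) with h | h
      · exact (h0 ▸ h).le
      · exact (h0.symm.trans h.1).le
    · rw [show j = 0 from Fin.ext hj]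
      exact h₄ k

section Glue

variable {n : ℕ}

/-- The filling of shape `κ + 1` that agrees with `S` on the shape `μ + 1`, has the letter `k` of
the largest index in the remaining boxes of `ν + 1` and in the first `t` boxes of the last row, and
the letter `k̄` elsewhere. -/
def glue (κ : Fin (n + 1) → ℕ) (μ ν : Fin n → ℕ) (t : ℕ) (S : Filling fun i => μ i + 1) :
    Filling fun i : Fin (n + 1) => κ i + 1 :=
  Fin.lastCases (motive := fun i => Fin (κ i + 1) → Letter (n + 1))
    (fun j => if (j : ℕ) < t then plain (Fin.last n) else barred (Fin.last n))
    (fun i j => if h : (j : ℕ) < μ i + 1 then liftLetter (S i ⟨j, h⟩)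
      else if (j : ℕ) < ν i + 1 then plain (Fin.last n) else barred (Fin.last n))

variable (κ : Fin (n + 1) → ℕ) (μ ν : Fin n → ℕ) (t : ℕ) (S : Filling fun i => μ i + 1)

theorem glue_last (j : Fin (κ (Fin.last n) + 1)) : glue κ μ ν t S (Fin.last n) j =
    if (j : ℕ) < t then plain (Fin.last n) else barred (Fin.last n) := by
  simp [glue]

theorem glue_castSucc (i : Fin n) (j : Fin (κ i.castSucc + 1)) : glue κ μ ν t S i.castSucc j =
    if h : (j : ℕ) < μ i + 1 then liftLetter (S i ⟨j, h⟩)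
      else if (j : ℕ) < ν i + 1 then plain (Fin.last n) else barred (Fin.last n) := by
  simp [glue]

theorem glue_last_lt_barred_iff (j : Fin (κ (Fin.last n) + 1)) :
    glue κ μ ν t S (Fin.last n) j < barred (Fin.last n) ↔ (j : ℕ) < t := by
  rw [glue_last]
  split_ifs with h <;> simp [h, plain_lt_barred]

theorem glue_castSucc_lt_plain_iff (i : Fin n) (j : Fin (κ i.castSucc + 1)) :
    glue κ μ ν t S i.castSucc j < plain (Fin.last n) ↔ (j : ℕ) < μ i + 1 := by
  rw [glue_castSucc]
  split_ifs with h h'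
  · exact iff_of_true (liftLetter_lt_plain_last _) h
  · exact iff_of_false (lt_irrefl _) h
  · exact iff_of_false (plain_lt_barred _).not_gt h

theorem glue_castSucc_lt_barred_iff (hμν : ∀ i, μ i ≤ ν i) (i : Fin n)
    (j : Fin (κ i.castSucc + 1)) :
    glue κ μ ν t S i.castSucc j < barred (Fin.last n) ↔ (j : ℕ) < ν i + 1 := by
  have := hμν i
  rw [glue_castSucc]
  split_ifs with h h'
  · exact iff_of_true ((liftLetter_lt_plain_last _).trans (plain_lt_barred _)) (by omega)
  · exact iff_of_true (plain_lt_barred _) h'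
  · exact iff_of_false (lt_irrefl _) h'

theorem glue_castSucc_of_lt {i : Fin n} {j : Fin (κ i.castSucc + 1)} (h : (j : ℕ) < μ i + 1) :
    glue κ μ ν t S i.castSucc j = liftLetter (S i ⟨j, h⟩) := by
  rw [glue_castSucc, dif_pos h]

theorem glue_castSucc_eq_plain {i : Fin n} {j : Fin (κ i.castSucc + 1)} (h : μ i < j)
    (h' : (j : ℕ) ≤ ν i) : glue κ μ ν t S i.castSucc j = plain (Fin.last n) := by
  rw [glue_castSucc, dif_neg (by omega), if_pos (by omega)]

end Glue

/-- The number of unbarred letters in the last row: none if `b`, and otherwise the number forced by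
the condition on `k̄` in row `k` together with strictness of columns. -/
def lastRowLength {n : ℕ} (κ : Fin (n + 1) → ℕ) (μ : Fin n → ℕ) (b : Bool) : ℕ :=
  if b then 0 else cap μ (κ (Fin.last n)) + 1

theorem isDifferenceTableau_glue {n : ℕ} {κ : Fin (n + 1) → ℕ} (hκ : Antitone κ)
    {ν μ : Fin n → ℕ} (hp : (ν, μ) ∈ interlacing κ) (b : Bool)
    {S : Filling fun i => μ i + 1} (hS : IsDifferenceTableau S) :
    IsDifferenceTableau (glue κ μ ν (lastRowLength κ μ b) S) := by
  have hμ : Antitone μ := antitone_of_mem_interlacing hp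
  obtain ⟨h₁, h₂, h₃, h₄⟩ := (mem_interlacing κ _).1 hp
  obtain ⟨s₁, s₂, s₃, s₄⟩ := (isDifferenceTableau_iff S).1 hS
  simp only at h₁ h₂ h₃ h₄ hμ
  have hcap : ∀ i, cap μ (κ (Fin.last n)) ≤ μ i := fun i => by
    have h := ((le_cap_iff μ (κ (Fin.last n)) _).1 le_rfl).2
    have hi := i.2
    exact (h ⟨n - 1, by omega⟩ (by simp; omega)).trans (hμ (Fin.le_def.2 (by simp; omega)))
  have ht : ∀ i, lastRowLength κ μ b ≤ μ i + 1 := fun i => by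
    have := hcap i
    rw [lastRowLength]
    split_ifs <;> omega
  -- A box lying below row `i` is in a column not exceeding `ν i`.
  have hbelow : ∀ (i : Fin n) (i' : Fin (n + 1)), i.castSucc < i' → κ i' ≤ ν i := fun i i' h =>
    (hκ (Fin.castSucc_lt_iff_succ_le.1 h)).trans (h₁ i)
  refine (isDifferenceTableau_iff _).2 ⟨fun i j j' hj => ?_, fun i i' j j' hi hj => ?_,
    fun k => ?_, fun k => ?_⟩
  · have hj' : (j : ℕ) ≤ j' := hj
    induction i using Fin.lastCases with
    | last =>
      rw [glue_last, glue_last]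
      split_ifs
      · exact le_rfl
      · exact (plain_lt_barred _).le
      · omega
      · exact le_rfl
    | cast i =>
      by_cases c₁ : (j' : ℕ) < μ i + 1
      · rw [glue_castSucc_of_lt _ _ _ _ _ c₁, glue_castSucc_of_lt _ _ _ _ _ (by omega),
          liftLetter_le_liftLetter]
        exact s₁ _ _ _ hj
      by_cases c₂ : (j' : ℕ) < ν i + 1
      · rw [glue_castSucc_eq_plain _ _ _ _ _ (j := j') (by omega) (by omega), ← lt_barred_last_iff,
          glue_castSucc_lt_barred_iff _ _ _ _ _ h₃]
        omega
      · rw [glue_castSucc _ _ _ _ _ _ j', dif_neg c₁, if_neg c₂]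
        exact le_barred_last _
  · have hj₁ : (j : ℕ) < κ i + 1 := j.2
    have hj₂ : (j' : ℕ) < κ i' + 1 := j'.2
    induction i using Fin.lastCases with
    | last => exact absurd hi (Fin.le_last _).not_gt
    | cast i =>
      have hb := hbelow i i' hi
      by_cases c : (j' : ℕ) < μ i + 1
      · induction i' using Fin.lastCases with
        | last =>
          refine lt_of_lt_of_le ((glue_castSucc_lt_plain_iff _ _ _ _ _ _ _).2 (by omega)) ?_
          rw [glue_last]
          split_ifs
          · exact le_rfl
          · exact (plain_lt_barred _).le
        | cast i' =>
          by_cases c' : (j' : ℕ) < μ i' + 1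
          · rw [glue_castSucc_of_lt _ _ _ _ _ c', glue_castSucc_of_lt _ _ _ _ _ (by omega),
              liftLetter_lt_liftLetter]
            exact s₂ _ _ _ _ (by simpa using hi) hj
          · refine lt_of_lt_of_le ((glue_castSucc_lt_plain_iff _ _ _ _ _ _ _).2 (by omega)) ?_
            exact not_lt.1 fun h => c' ((glue_castSucc_lt_plain_iff _ _ _ _ _ _ _).1 h)
      · rw [glue_castSucc_eq_plain _ _ _ _ _ (by omega) (by omega)]
        refine (plain_lt_barred _).trans_le (not_lt.1 ?_)
        induction i' using Fin.lastCases with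
        | last =>
          rw [glue_last_lt_barred_iff]
          have := ht i
          omega
        | cast i' =>
          rw [glue_castSucc_lt_barred_iff _ _ _ _ _ h₃]
          have hi' : (i : ℕ) < i' := by simpa using hi
          have h5 := h₄ i ⟨i + 1, by omega⟩ rfl
          -- Along the rows `i + 1 ≤ i'` the sequence `ν` decreases, as it interlaces `κ`.
          have h6 : ν i' ≤ ν ⟨i + 1, by omega⟩ := by
            rcases Nat.lt_or_ge ((i : ℕ) + 1) i' with h | h
            · refine (h₂ i').trans (hbelow _ _ ?_)
              simpa [Fin.lt_def] using h
            · exact (congrArg ν (Fin.ext (by simp; omega))).le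
          omega
  · rintro ⟨j₀, hj₀⟩ j hj
    induction k using Fin.lastCases with
    | last =>
      have c₀ := (glue_last_lt_barred_iff _ _ _ _ _ _).1 (hj₀.trans_lt (plain_lt_barred _))
      have c : ¬ (j : ℕ) < lastRowLength κ μ b := fun h =>
        ((glue_last_lt_barred_iff κ μ ν _ S _).2 h).ne hj
      have hj₂ : (j : ℕ) < κ (Fin.last n) + 1 := j.2
      cases b with
      | true => simp [lastRowLength] at c₀
      | false =>
        simp only [lastRowLength, Bool.false_eq_true, if_false] at c
        have h := mt (le_cap_iff μ (κ (Fin.last n)) j).2 (by omega)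
        push Not at h
        obtain ⟨i, hi, hij⟩ := h (by omega)
        have hb := hbelow i (Fin.last n) (Fin.castSucc_lt_last _)
        refine ⟨i.castSucc, ⟨j, ?_⟩, by simpa using hi, rfl,
          glue_castSucc_eq_plain _ _ _ _ _ hij (by simp; omega)⟩
        have := h₂ i
        omega
    | cast k =>
      have c₀ := (glue_castSucc_lt_plain_iff κ μ ν _ S _ _).1
        (hj₀.trans_lt (plain_castSucc_lt k))
      have c := (glue_castSucc_lt_plain_iff κ μ ν _ S _ _).1 (hj.trans_lt (barred_castSucc_lt k))
      rw [glue_castSucc_of_lt _ _ _ _ _ c₀, ← liftLetter_plain] at hj₀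
      rw [glue_castSucc_of_lt _ _ _ _ _ c, ← liftLetter_barred] at hj
      obtain ⟨i, j', hi, hj', hij⟩ := s₃ k ⟨_, liftLetter_injective hj₀⟩ _ (liftLetter_injective hj)
      have hj₂ : (j' : ℕ) < μ i + 1 := j'.2
      refine ⟨i.castSucc, ⟨j', ?_⟩, by simpa using hi, hj', ?_⟩
      · have := h₂ i; have := h₃ i; omega
      · rw [glue_castSucc_of_lt _ _ _ _ _ hj₂, ← liftLetter_plain, ← hij]
  · induction k using Fin.lastCases with
    | last =>
      rw [glue_last]
      split_ifs <;> simp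
    | cast k =>
      rw [glue_castSucc_of_lt _ _ _ _ _ (by simp), ← liftLetter_plain, ← liftLetter_barred]
      exact (s₄ k).imp (congrArg liftLetter) (congrArg liftLetter)

theorem exists_threshold {N : ℕ} (P : Fin N → Prop) (hP : ∀ i j, i ≤ j → P j → P i) :
    ∃ p ≤ N, ∀ c : Fin N, P c ↔ (c : ℕ) < p := by
  classical
  have hN : ∃ m : ℕ, ∀ c : Fin N, m ≤ (c : ℕ) → ¬ P c := ⟨N, fun c hc => absurd c.2 (by omega)⟩
  refine ⟨Nat.find hN, Nat.find_min' hN fun c hc => absurd c.2 (by omega), fun c => ⟨fun h => ?_,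
    fun h => ?_⟩⟩
  · by_contra h'
    exact Nat.find_spec hN c (not_lt.1 h') h
  · by_contra h'
    exact absurd (Nat.find_min' hN fun d hd hPd => h' (hP c d hd hPd)) (not_le.2 h)

theorem threshold_unique {N p q : ℕ} (hp : p ≤ N) (hq : q ≤ N)
    (h : ∀ c : Fin N, (c : ℕ) < p ↔ (c : ℕ) < q) : p = q := by
  rcases lt_trichotomy p q with hpq | hpq | hpq
  · have := h ⟨p, by omega⟩
    simp at this
    omega
  · exact hpq
  · have := h ⟨q, by omega⟩
    simp at this
    omega

/-- Every difference tableau is glued from its letters of smaller index. The lengths of the pieces of a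
row are the thresholds at which its entries reach `k` and `k̄`, for the largest index `k`. -/
theorem exists_eq_glue {n : ℕ} {κ : Fin (n + 1) → ℕ} (hκ : Antitone κ)
    {T : Filling fun i => κ i + 1} (hT : IsDifferenceTableau T) :
    ∃ ν μ : Fin n → ℕ, (ν, μ) ∈ interlacing κ ∧ ∃ (b : Bool) (S : Filling fun i => μ i + 1),
      IsDifferenceTableau S ∧ glue κ μ ν (lastRowLength κ μ b) S = T := by
  obtain ⟨t₁, t₂, t₃, t₄⟩ := (isDifferenceTableau_iff T).1 hT
  have hP : ∀ i : Fin (n + 1), ∃ p ≤ κ i + 1, ∀ c, T i c < plain (Fin.last n) ↔ (c : ℕ) < p :=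
    fun i => exists_threshold _ fun c d hcd h => (t₁ i c d hcd).trans_lt h
  have hQ : ∀ i : Fin (n + 1), ∃ q ≤ κ i + 1, ∀ c, T i c < barred (Fin.last n) ↔ (c : ℕ) < q :=
    fun i => exists_threshold _ fun c d hcd h => (t₁ i c d hcd).trans_lt h
  choose P hPκ hP using hP
  choose Q hQκ hQ using hQ
  have hlast : ∀ j, T (Fin.last n) j < barred (Fin.last n) →
      T (Fin.last n) j = plain (Fin.last n) := fun j hj => by
    refine le_antisymm (lt_barred_last_iff.1 hj) ?_
    have h0 : plain (Fin.last n) ≤ T (Fin.last n) 0 := by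
      rcases t₄ (Fin.last n) with h | h <;> rw [h]
      exact (plain_lt_barred _).le
    exact h0.trans (t₁ _ _ _ (Fin.zero_le _))
  have hPpos : ∀ i : Fin n, 0 < P i.castSucc := fun i => by
    refine (hP i.castSucc 0).1 ?_
    rcases t₄ i.castSucc with h | h <;> rw [h]
    exacts [plain_castSucc_lt i, barred_castSucc_lt i]
  have hPQ : ∀ i, P i ≤ Q i := fun i => by
    by_contra! h
    have hi := hPκ i
    have h1 := (hP i ⟨Q i, by simp only; omega⟩).2 h
    exact lt_irrefl _ ((hQ i ⟨Q i, by simp only; omega⟩).1 (h1.trans (plain_lt_barred _)))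
  -- An entry of a row other than the first is at most `k̄`, so the entry above it is at most `k`;
  -- if the former is at most `k`, the latter has a smaller index.
  have habove : ∀ (i i' : Fin (n + 1)) (c : ℕ), i < i' → c ≤ κ i' → c < Q i := by
    intro i i' c hi hc
    have hc' := hκ hi.le
    exact (hQ i ⟨c, by simp only; omega⟩).1
      ((t₂ i i' _ ⟨c, by omega⟩ hi rfl).trans_le (le_barred_last _))
  have habove' : ∀ (i i' : Fin (n + 1)) (c : ℕ), i < i' → c < Q i' → c < P i := by
    intro i i' c hi hc
    have hc' := hκ hi.le
    have hQ' := hQκ i'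
    exact (hP i ⟨c, by simp only; omega⟩).1 ((t₂ i i' _ ⟨c, by omega⟩ hi rfl).trans_le
      (lt_barred_last_iff.1 ((hQ i' ⟨c, by simp only; omega⟩).2 hc)))
  set μ : Fin n → ℕ := fun i => P i.castSucc - 1 with hμ
  set ν : Fin n → ℕ := fun i => Q i.castSucc - 1 with hν
  have hμ1 : ∀ i, μ i + 1 = P i.castSucc := fun i => Nat.sub_add_cancel (hPpos i)
  have hν1 : ∀ i, ν i + 1 = Q i.castSucc := fun i =>
    Nat.sub_add_cancel ((hPpos i).trans_le (hPQ _))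
  have hmem : (ν, μ) ∈ interlacing κ := by
    refine (mem_interlacing _ _).2 ⟨fun j => ?_, fun j => ?_, fun j => ?_, fun i j hij => ?_⟩
    · have := habove j.castSucc j.succ (κ j.succ) Fin.castSucc_lt_succ le_rfl
      have := hν1 j
      simp only; omega
    · have := hQκ j.castSucc
      have := hν1 j
      simp only; omega
    · have := hPQ j.castSucc
      simp only [hμ, hν]; omega
    · have := habove' i.castSucc j.castSucc (ν j) 
        (Fin.castSucc_lt_castSucc_iff.2 (Fin.lt_def.2 (by omega)))
        (by have := hν1 j; omega)
      have := hμ1 i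
      simp only; omega
  have hS : ∀ (i : Fin n) (c : Fin (μ i + 1)), ∃ f : Letter n, liftLetter f = T i.castSucc
      ⟨c, by have := hμ1 i; have := hPκ i.castSucc; have := c.2; simp only; omega⟩ :=
    fun i c =>
    exists_liftLetter_eq ((hP _ _).2 (by have := hμ1 i; have := c.2; simp only; omega))
  choose S hS using hS
  have hSD : IsDifferenceTableau S := by
    refine (isDifferenceTableau_iff S).2 ⟨fun i j j' hj => ?_, fun i i' j j' hi hj => ?_, ?_,
      fun k => ?_⟩
    · rw [← liftLetter_le_liftLetter, hS, hS]
      exact t₁ _ _ _ hj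
    · rw [← liftLetter_lt_liftLetter, hS, hS]
      exact t₂ _ _ _ _ (by simpa using hi) hj
    · rintro k ⟨j₀, hj₀⟩ j hj
      rw [← liftLetter_injective.eq_iff, hS, liftLetter_plain] at hj₀
      rw [← liftLetter_injective.eq_iff, hS, liftLetter_barred] at hj
      obtain ⟨i, j', hi, hj', hij⟩ := t₃ k.castSucc ⟨_, hj₀⟩ _ hj
      have hin : (i : ℕ) < n := by have := k.2; simp at hi; omega
      obtain ⟨i, rfl⟩ : ∃ i' : Fin n, i'.castSucc = i := ⟨⟨i, hin⟩, rfl⟩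
      have hj'' : (j' : ℕ) < μ i + 1 := by
        rw [hμ1, ← hP, hij]
        exact plain_castSucc_lt k
      exact ⟨i, ⟨j', hj''⟩, hi, hj', liftLetter_injective ((hS _ _).trans hij)⟩
    · rw [← liftLetter_injective.eq_iff, ← liftLetter_injective.eq_iff (b := barred k), hS]
      exact t₄ k.castSucc
  have hlen : ∃ b, lastRowLength κ μ b = Q (Fin.last n) := by
    by_cases hq : Q (Fin.last n) = 0
    · exact ⟨true, by simp [lastRowLength, hq]⟩
    refine ⟨false, ?_⟩
    have hQL := hQκ (Fin.last n)
    have h0 := hlast 0 ((hQ _ _).2 (by simp; omega))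
    have h₁ : Q (Fin.last n) - 1 ≤ cap μ (κ (Fin.last n)) :=
      (le_cap_iff _ _ _).2 ⟨by omega, fun i _ => by
        have := habove' i.castSucc (Fin.last n) (Q (Fin.last n) - 1) (Fin.castSucc_lt_last _)
          (by omega)
        have := hμ1 i
        omega⟩
    obtain ⟨h₂, h₃⟩ := (le_cap_iff μ (κ (Fin.last n)) _).1 le_rfl
    have h₄ : cap μ (κ (Fin.last n)) < Q (Fin.last n) := by
      by_contra! h
      have hb : T (Fin.last n) ⟨Q (Fin.last n), by simp only; omega⟩ = barred (Fin.last n) :=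
        (le_barred_last _).eq_of_not_lt fun h' => lt_irrefl _ ((hQ _ _).1 h')
      obtain ⟨i, j', hi, hj', hij⟩ := t₃ _ ⟨0, h0⟩ _ hb
      have hin : (i : ℕ) < n := by simp at hi; omega
      obtain ⟨i, rfl⟩ : ∃ i' : Fin n, i'.castSucc = i := ⟨⟨i, hin⟩, rfl⟩
      have h5 := h₃ i (by simpa using hi)
      have h6 := (not_congr (hP i.castSucc j')).1 hij.ge.not_gt
      have h7 := hμ1 i
      simp only at hj'
      omega
    simp only [lastRowLength, Bool.false_eq_true, if_false]
    omega
  obtain ⟨b, hb⟩ := hlen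
  refine ⟨ν, μ, hmem, b, S, hSD, ?_⟩
  funext i j
  induction i using Fin.lastCases with
  | last =>
    rw [glue_last, hb]
    split_ifs with h
    · exact (hlast _ ((hQ _ _).2 h)).symm
    · exact ((le_barred_last _).eq_of_not_lt (mt (hQ _ _).1 h)).symm
  | cast i =>
    rw [glue_castSucc, hν1]
    split_ifs with h h'
    · exact hS _ _
    · refine le_antisymm (not_lt.1 (mt (hP _ _).1 (by rwa [← hμ1])))
        (lt_barred_last_iff.1 ((hQ _ _).2 h'))
    · exact ((le_barred_last _).eq_of_not_lt (mt (hQ _ _).1 h')).symm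

theorem glue_injective {n : ℕ} {κ : Fin (n + 1) → ℕ} {ν μ ν' μ' : Fin n → ℕ}
    (hp : (ν, μ) ∈ interlacing κ) (hp' : (ν', μ') ∈ interlacing κ) {b b' : Bool}
    {S : Filling fun i => μ i + 1} {S' : Filling fun i => μ' i + 1}
    (h : glue κ μ ν (lastRowLength κ μ b) S = glue κ μ' ν' (lastRowLength κ μ' b') S') :
    ν = ν' ∧ μ = μ' ∧ b = b' ∧ HEq S S' := by
  obtain ⟨-, h₂, h₃, -⟩ := (mem_interlacing κ _).1 hp
  obtain ⟨-, h₂', h₃', -⟩ := (mem_interlacing κ _).1 hp'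
  simp only at h₂ h₃ h₂' h₃'
  obtain rfl : μ = μ' := funext fun i => Nat.succ_injective <|
    threshold_unique (N := κ i.castSucc + 1) (by have := h₂ i; have := h₃ i; omega)
      (by have := h₂' i; have := h₃' i; omega) fun c => by
        have := glue_castSucc_lt_plain_iff κ μ ν (lastRowLength κ μ b) S i c
        rwa [h, glue_castSucc_lt_plain_iff, iff_comm] at this
  obtain rfl : ν = ν' := funext fun i => Nat.succ_injective <|
    threshold_unique (N := κ i.castSucc + 1) (by have := h₂ i; omega)
      (by have := h₂' i; omega) fun c => by
        have := glue_castSucc_lt_barred_iff κ μ ν (lastRowLength κ μ b) S h₃ i c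
        rwa [h, glue_castSucc_lt_barred_iff _ _ _ _ _ h₃', iff_comm] at this
  have hb : lastRowLength κ μ b = lastRowLength κ μ b' := by
    have hle : ∀ b, lastRowLength κ μ b ≤ κ (Fin.last n) + 1 := fun b => by
      have := ((le_cap_iff μ (κ (Fin.last n)) _).1 le_rfl).1
      rw [lastRowLength]
      split_ifs <;> omega
    refine threshold_unique (hle b) (hle b') fun c => ?_
    rw [← glue_last_lt_barred_iff κ μ ν _ S c, h, glue_last_lt_barred_iff]
  refine ⟨rfl, rfl, by cases b <;> cases b' <;> simp [lastRowLength] at hb ⊢, heq_of_eq ?_⟩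
  funext i c
  have hc : (c : ℕ) < κ i.castSucc + 1 := by
    have := h₂ i; have := h₃ i; have : (c : ℕ) < μ i + 1 := c.2; omega
  have := congrFun (congrFun h i.castSucc) ⟨c, hc⟩
  rw [glue_castSucc_of_lt _ _ _ _ _ c.2, glue_castSucc_of_lt _ _ _ _ _ c.2] at this
  exact liftLetter_injective this

/-! ### The branching recursion for the tableau sum -/

theorem prod_fin_threshold {M : Type*} [CommMonoid M] {p q N : ℕ} (hpq : p ≤ q) (hqN : q ≤ N)
    (A : Fin p → M) (B C : ℕ → M) :
    (∏ j : Fin N, if h : (j : ℕ) < p then A ⟨j, h⟩ else if (j : ℕ) < q then B j else C j) =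
      (∏ j, A j) * ((∏ j ∈ Finset.Ico p q, B j) * ∏ j ∈ Finset.Ico q N, C j) := by
  set f : ℕ → M := fun j => if h : j < p then A ⟨j, h⟩ else if j < q then B j else C j with hf
  refine (Fin.prod_univ_eq_prod_range f N).trans ?_
  rw [Finset.range_eq_Ico, ← Finset.prod_Ico_consecutive f (Nat.zero_le p) (hpq.trans hqN),
    ← Finset.prod_Ico_consecutive f hpq hqN, ← Finset.range_eq_Ico,
    ← Fin.prod_univ_eq_prod_range f p]
  refine congr_arg₂ _ (Finset.prod_congr rfl fun j _ => ?_) (congr_arg₂ _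
    (Finset.prod_congr rfl fun j hj => ?_) (Finset.prod_congr rfl fun j hj => ?_))
  · simp [hf]
  · have := Finset.mem_Ico.1 hj
    simp only [hf]
    rw [dif_neg (by omega), if_pos (by omega)]
  · have := Finset.mem_Ico.1 hj
    simp only [hf]
    rw [dif_neg (by omega), if_neg (by omega)]

theorem neg_one_pow_bar {R : Type*} [CommRing R] {n : ℕ} {κ : Fin n → ℕ}
    (T : Filling fun i => κ i + 1) :
    (-1 : R) ^ bar T = ∏ i, if isBarred (T i 0) = true then -1 else 1 := by
  classical
  rw [Finset.prod_ite, Finset.prod_const, Finset.prod_const_one, mul_one, bar]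
  congr 2
  ext i
  simp only [Finset.mem_filter, Finset.mem_univ, true_and]
  refine ⟨?_, fun h => ⟨0, rfl, h⟩⟩
  rintro ⟨j, hj, h⟩
  rwa [show j = 0 from Fin.ext hj] at h

section Weights

variable {K : Type*} [Field K] {n : ℕ} (x : Fin (n + 1) → K) (a : ℕ → K)

theorem extendedParam_shiftParam (m : ℤ) :
    extendedParam (shiftParam a) m = extendedParam a (m - 1) := by
  by_cases h : 0 < m
  · rw [extendedParam, if_pos h, shiftParam, Int.toNat_of_nonneg h.le]
  · rw [extendedParam, extendedParam, if_neg h, if_neg (by omega)]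

theorem extendedParam_natCast_succ (m : ℕ) : extendedParam a ((m : ℤ) + 1) = a (m + 1) := by
  rw [extendedParam, if_pos (by positivity)]
  rfl

theorem letterWeight_liftLetter (i j : ℕ) (e : Letter n) :
    letterWeight x a i j (liftLetter e) =
      letterWeight (fun i => x i.castSucc) (shiftParam a) i j e := by
  have h₁ : index (liftLetter e) = (index e).castSucc := rfl
  have h₂ : isBarred (liftLetter e) = isBarred e := rfl
  simp only [letterWeight, h₁, h₂, Fin.val_castSucc, extendedParam_shiftParam]
  push_cast
  split_ifs
  · congr 2; ring
  all_goals congr 2; ring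

theorem letterWeight_plain_last {i c : ℕ} (hi : i < n) :
    letterWeight x a (i + 1) (c + 1) (plain (Fin.last n)) =
      x (Fin.last n) + a (c + (n - i - 1) + 1) := by
  rw [← extendedParam_natCast_succ a]
  have h₁ : index (plain (Fin.last n)) = Fin.last n := rfl
  have h₂ : isBarred (plain (Fin.last n)) = false := rfl
  simp only [letterWeight, h₁, h₂, Fin.val_last, Bool.false_eq_true, if_false]
  rw [if_neg (by omega)]
  congr 2
  omega

theorem letterWeight_plain_last_last (c : ℕ) :
    letterWeight x a (n + 1) (c + 1) (plain (Fin.last n)) = x (Fin.last n) + a (c + 1) := by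
  rw [← extendedParam_natCast_succ a]
  have h₁ : index (plain (Fin.last n)) = Fin.last n := rfl
  have h₂ : isBarred (plain (Fin.last n)) = false := rfl
  simp only [letterWeight, h₁, h₂, Fin.val_last, Bool.false_eq_true, if_false, if_true]
  congr 2
  omega

theorem letterWeight_barred_last {i c : ℕ} (hi : i ≤ n) :
    letterWeight x a (i + 1) (c + 1) (barred (Fin.last n)) =
      (x (Fin.last n))⁻¹ + a (c + (n - i) + 1) := by
  rw [← extendedParam_natCast_succ a]
  have h₁ : index (barred (Fin.last n)) = Fin.last n := rfl
  have h₂ : isBarred (barred (Fin.last n)) = true := rfl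
  simp only [letterWeight, h₁, h₂, Fin.val_last, if_true]
  congr 2
  omega

variable {κ : Fin (n + 1) → ℕ} {ν μ : Fin n → ℕ}

theorem prod_letterWeight_glue_castSucc (h : (ν, μ) ∈ interlacing κ) (t : ℕ)
    (S : Filling fun i => μ i + 1) (i : Fin n) :
    ∏ j : Fin (κ i.castSucc + 1), letterWeight x a ((i : ℕ) + 1) ((j : ℕ) + 1)
        (glue κ μ ν t S i.castSucc j) =
      (∏ j : Fin (μ i + 1), letterWeight (fun i => x i.castSucc) (shiftParam a) ((i : ℕ) + 1)
        ((j : ℕ) + 1) (S i j)) *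
      ((∏ l ∈ Finset.Ico (μ i) (ν i), (x (Fin.last n) + a (l + (n - i) + 1))) *
        ∏ l ∈ Finset.Ico (ν i) (κ i.castSucc), ((x (Fin.last n))⁻¹ + a (l + (n - i) + 2))) := by
  obtain ⟨-, h₂, h₃, -⟩ := (mem_interlacing κ _).1 h
  have e := prod_fin_threshold (Nat.succ_le_succ (h₃ i)) (Nat.succ_le_succ (h₂ i))
    (fun j => letterWeight (fun i => x i.castSucc) (shiftParam a) ((i : ℕ) + 1) ((j : ℕ) + 1)
        (S i j))
    (fun c => x (Fin.last n) + a (c + (n - i - 1) + 1))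
    (fun c => (x (Fin.last n))⁻¹ + a (c + (n - i) + 1))
  simp only [Nat.succ_eq_add_one, ← Finset.prod_Ico_add'] at e
  refine Eq.trans (Finset.prod_congr rfl fun j _ => ?_) (e.trans ?_)
  · rw [glue_castSucc]
    split_ifs
    · exact letterWeight_liftLetter ..
    · exact letterWeight_plain_last x a i.2
    · exact letterWeight_barred_last x a i.2.le
  · have hi := i.2
    refine congr_arg₂ _ rfl (congr_arg₂ _ (Finset.prod_congr rfl fun l _ => ?_)
      (Finset.prod_congr rfl fun l _ => ?_)) <;> congr 2 <;> omega

theorem prod_letterWeight_glue_last (t : ℕ) (ht : t ≤ κ (Fin.last n) + 1)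
    (S : Filling fun i => μ i + 1) :
    ∏ j : Fin (κ (Fin.last n) + 1), letterWeight x a (n + 1) ((j : ℕ) + 1)
        (glue κ μ ν t S (Fin.last n) j) =
      factorialPower a (x (Fin.last n)) t *
        ∏ l ∈ Finset.Ico t (κ (Fin.last n) + 1), ((x (Fin.last n))⁻¹ + a (l + 1)) := by
  have e := prod_fin_threshold (Nat.zero_le t) ht (fun _ => (1 : K))
    (fun c => x (Fin.last n) + a (c + 1)) (fun c => (x (Fin.last n))⁻¹ + a (c + 1))
  simp only [Nat.not_lt_zero, dite_false, Finset.prod_const_one, one_mul,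
    ← Finset.range_eq_Ico] at e
  refine Eq.trans (Finset.prod_congr rfl fun j _ => ?_) e
  rw [glue_last]
  split_ifs
  · exact letterWeight_plain_last_last x a j
  · simpa using letterWeight_barred_last x a (c := j) (le_refl n)

theorem sum_lastRow_eq (S : Filling fun i => μ i + 1) :
    ∑ b : Bool, (if isBarred (glue κ μ ν (lastRowLength κ μ b) S (Fin.last n) 0) = true
        then (-1 : K) else 1) *
      ∏ j : Fin (κ (Fin.last n) + 1), letterWeight x a (n + 1) ((j : ℕ) + 1)
        (glue κ μ ν (lastRowLength κ μ b) S (Fin.last n) j) =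
    lastRowWeight a (x (Fin.last n)) (cap μ (κ (Fin.last n))) (κ (Fin.last n)) := by
  have hcap := ((le_cap_iff μ (κ (Fin.last n)) _).1 le_rfl).1
  have hp : isBarred (plain (Fin.last n)) = false := rfl
  have hb : isBarred (barred (Fin.last n)) = true := rfl
  rw [Fintype.sum_bool, prod_letterWeight_glue_last x a _ (by simp [lastRowLength]),
    prod_letterWeight_glue_last x a _ (by simp [lastRowLength, hcap]), glue_last, glue_last,
    lastRowWeight]
  simp only [lastRowLength, if_true, Bool.false_eq_true, if_false, Fin.val_zero, lt_irrefl,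
    Nat.succ_pos, hp, hb, ← Finset.prod_Ico_add', ← Finset.range_eq_Ico, one_mul]
  simp only [factorialPower, Finset.range_zero, Finset.prod_empty, add_assoc, one_add_one_eq_two]
  ring

/-- The signed weighted sum over the difference tableaux of shape `κ + 1`. -/
noncomputable def tableauSum {n : ℕ} (κ : Fin n → ℕ) (x : Fin n → K) (a : ℕ → K) : K :=
  ∑ T ∈ differenceTableaux fun i => κ i + 1, (-1) ^ bar T * weight x a T

theorem signedWeight_glue (h : (ν, μ) ∈ interlacing κ) (t : ℕ) (S : Filling fun i => μ i + 1) :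
    (-1) ^ bar (glue κ μ ν t S) * weight x a (glue κ μ ν t S) =
      (∏ i : Fin n,
        ((∏ l ∈ Finset.Ico (μ i) (ν i), (x (Fin.last n) + a (l + (n - i) + 1))) *
          ∏ l ∈ Finset.Ico (ν i) (κ i.castSucc), ((x (Fin.last n))⁻¹ + a (l + (n - i) + 2)))) *
      ((if isBarred (glue κ μ ν t S (Fin.last n) 0) = true then (-1 : K) else 1) *
        ∏ j : Fin (κ (Fin.last n) + 1), letterWeight x a (n + 1) ((j : ℕ) + 1)
        (glue κ μ ν t S (Fin.last n) j)) *
      ((-1) ^ bar S * weight (fun i => x i.castSucc) (shiftParam a) S) := by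
  have h0 : ∀ i : Fin n, isBarred (glue κ μ ν t S i.castSucc 0) = isBarred (S i 0) := fun i => by
    rw [glue_castSucc_of_lt _ _ _ _ _ (by simp)]
    rfl
  rw [neg_one_pow_bar, neg_one_pow_bar, weight, weight, Fin.prod_univ_castSucc,
    Fin.prod_univ_castSucc]
  simp only [h0, Fin.val_castSucc, Fin.val_last, prod_letterWeight_glue_castSucc x a h,
    Finset.prod_mul_distrib]
  ring

theorem tableauSum_succ (κ : Fin (n + 1) → ℕ) (hκ : Antitone κ) :
    tableauSum κ x a = ∑ p ∈ interlacing κ,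
      (∏ i : Fin n,
        ((∏ l ∈ Finset.Ico (p.2 i) (p.1 i), (x (Fin.last n) + a (l + (n - i) + 1))) *
          ∏ l ∈ Finset.Ico (p.1 i) (κ i.castSucc),
            ((x (Fin.last n))⁻¹ + a (l + (n - i) + 2)))) *
        lastRowWeight a (x (Fin.last n)) (cap p.2 (κ (Fin.last n))) (κ (Fin.last n)) *
        tableauSum p.2 (fun i => x i.castSucc) (shiftParam a) := by
  have hbij : tableauSum κ x a =
      ∑ q ∈ (interlacing κ).sigma fun p => (Finset.univ : Finset Bool) ×ˢ
        differenceTableaux fun i => p.2 i + 1,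
      (-1) ^ bar (glue κ q.1.2 q.1.1 (lastRowLength κ q.1.2 q.2.1) q.2.2) *
        weight x a (glue κ q.1.2 q.1.1 (lastRowLength κ q.1.2 q.2.1) q.2.2) := by
    refine (Finset.sum_bij
      (fun q _ => glue κ q.1.2 q.1.1 (lastRowLength κ q.1.2 q.2.1) q.2.2) ?_ ?_ ?_ ?_).symm
    · rintro ⟨⟨ν, μ⟩, b, S⟩ hq
      simp only [Finset.mem_sigma, Finset.mem_product, differenceTableaux, Finset.mem_filter,
        Finset.mem_univ, true_and] at hq ⊢
      exact isDifferenceTableau_glue hκ hq.1 b hq.2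
    · rintro ⟨⟨ν, μ⟩, b, S⟩ hq ⟨⟨ν', μ'⟩, b', S'⟩ hq' h
      obtain ⟨rfl, rfl, rfl, hS⟩ :=
        glue_injective (Finset.mem_sigma.1 hq).1 (Finset.mem_sigma.1 hq').1 h
      obtain rfl : S = S' := eq_of_heq hS
      rfl
    · intro T hT
      simp only [differenceTableaux, Finset.mem_filter, Finset.mem_univ, true_and] at hT
      obtain ⟨ν, μ, hp, b, S, hS, h⟩ := exists_eq_glue hκ hT
      exact ⟨⟨(ν, μ), b, S⟩, by simp [differenceTableaux, hp, hS], h⟩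
    · exact fun _ _ => rfl
  rw [hbij, Finset.sum_sigma]
  refine Finset.sum_congr rfl fun p hp => ?_
  rw [Finset.sum_product_right, tableauSum, Finset.mul_sum]
  refine Finset.sum_congr rfl fun S _ => ?_
  simp only [signedWeight_glue x a (show (p.1, p.2) ∈ interlacing κ from hp)]
  rw [← Finset.sum_mul, ← Finset.mul_sum, sum_lastRow_eq]

end Weights

/-- The numerator and the tableau sum satisfy the same recursion, up to the factor by which the
products `diffProd` for `n + 1` and `n` variables differ. -/
theorem numerator_eq_diffProd_mul_tableauSum {K : Type*} [Field K] {n : ℕ} (κ : Fin n → ℕ)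
    (hκ : Antitone κ) (x : Fin n → K) (hx : ∀ i, x i ≠ 0) (a : ℕ → K) :
    numerator κ x a = diffProd x * tableauSum κ x a := by
  induction n generalizing a with
  | zero =>
    have h : differenceTableaux (fun i => κ i + 1) = Finset.univ := by
      ext T
      simp [differenceTableaux, isDifferenceTableau_iff]
    rw [tableauSum, h, Fintype.sum_unique]
    simp [numerator, diffProd, bar, weight]
  | succ n ih =>
    rw [numerator_succ a κ hκ x hx, diffProd_succ, tableauSum_succ x a κ hκ, mul_assoc]
    congr 1
    rw [Finset.mul_sum]
    refine Finset.sum_congr rfl fun p hp => ?_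
    rw [ih p.2 (antitone_of_mem_interlacing hp) _ fun i => hx i.castSucc]
    ring

end EvenOrthogonal

theorem theorem3 {K : Type*} [Field K] (n : ℕ) (hn : 1 ≤ n)
    (lam : Fin n → ℕ) (hanti : Antitone lam) (hlen : ∀ i, 0 < lam i)
    (x : Fin n → K) (hx : ∀ i, x i ≠ 0) (a : ℕ → K)
    (hden : EvenOrthogonal.charDenominator x a ≠ 0) :
    EvenOrthogonal.differenceCharacter lam x a =
      ∑ T ∈ EvenOrthogonal.differenceTableaux lam,
        (-1) ^ EvenOrthogonal.bar T * EvenOrthogonal.weight x a T := by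
  obtain ⟨κ, rfl⟩ : ∃ κ : Fin n → ℕ, lam = fun i => κ i + 1 :=
    ⟨fun i => lam i - 1, funext fun i => (Nat.sub_add_cancel (hlen i)).symm⟩
  have hκ : Antitone κ := fun i j hij => Nat.le_of_succ_le_succ (hanti hij)
  -- In characteristic `2` the factor `1 / 2` is `0`, and so is the denominator.
  have h2 : (2 : K) ≠ 0 := fun h => hden (by simp [EvenOrthogonal.charDenominator, h])
  refine (div_eq_iff hden).2 ?_
  rw [EvenOrthogonal.charDenominator_eq hn x hx a h2, mul_comm]
  exact EvenOrthogonal.numerator_eq_diffProd_mul_tableauSum κ hκ x hx a
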